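/- A graph is a finite directed multigraph $G=(V,E)$ (loops and repeated edges allowed) with node weights $b:V\to\mathbb{R}_{\ge 0}$. Write $\Gamma^-_v(G)$ for the multiset of incoming edges of $v$, $\deg^+_u(G)$ for the number of outgoing edges of $u$, and $\#_{(u,v)}(G)$ for the multiplicity of the edge $(u,v)$. A path has at least one edge; $\mathrm{dist}_{u,v}(G)$ is the number of edges of a shortest path from $u$ to $v$. $G$ is strongly connected if $V\neq\emptyset$ and there is a path from every node to every node (itself included); $\mathcal{SCG}$ denotes the class of these graphs. $\lambda(G)$ is the largest real eigenvalue of the matrix $A=(a_{u,v})$, $a_{u,v}=\#_{(v,u)}(G)$, and for $a\in(0,1)$, $\mathcal{KG}^a$ is the class of graphs with $\lambda(G)<1/a$. Distinct nodes $u,w$ are out-twins if $\#_{(u,t)}(G)=\#_{(w,t)}(G)$ for all $t\in V$. Then $R_{u\to w}(G,b)$ is obtained by deleting $u$ with all its incident edges, adding an edge $(v,w)$ for each former edge $(v,u)$ with $v\ne u$ (with multiplicity), giving $w$ the weight $b(u)+b(w)$ and keeping all other weights. A centrality measure $F$ defined on a class $\mathcal{G}$ satisfies *Node Redirect on $\mathcal{G}$*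 if for all $G\in\mathcal{G}$, weights $b$ and out-twins $u,w$ such that the graph of $R_{u\to w}(G,b)$ is in $\mathcal{G}$, $$F_v(G,b)=F_v(R_{u\to w}(G,b))\ \text{ for all } v\in V\setminus\{u,w\},\qquad F_u(G,b)+F_w(G,b)=F_w(R_{u\to w}(G,b)).$$ **Proposition.** (1) Each of the following systems has, for every graph in the indicated class and all node weights, exactly one real solution, and that solution is non-negative; the centrality measure that it defines satisfies Node Redirect on that class: - eigenvector centrality, on $\mathcal{SCG}$: $x_v=\frac{1}{\lambda(G)}\sum_{(u,v)\in\Gamma^-_v(G)}x_u$ for all $v$, and $\sum_v x_v=1$; - Katz prestige, on $\mathcal{SCG}$: $x_v=\sum_{(u,v)\in\Gamma^-_v(G)}x_u/\deg^+_u(G)$ for all $v$, and $\sum_v x_v=1$; - Katz centrality, on $\mathcal{KG}^a$, for every $a\in(0,1)$: $x_v=a\sum_{(u,v)\in\Gamma^-_v(G)}x_u+b(v)$ for all $v$; - Bonacich centrality, on $\mathcal{KG}^a$, for every $a\in(0,1)$: $x_v=\sum_{(u,v)\in\Gamma^-_v(G)}(a\,x_u+b(u))$ for all $v$. (2) Node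 Redirect is not satisfied by degree centrality $D_v=|\Gamma^-_v(G)|$, the beta measure $\beta_v=\sum_{(u,v)\in\Gamma^-_v(G)}1/\deg^+_u(G)$, decay centrality $Y^a_v=\sum_{u\ne v}a^{\mathrm{dist}_{u,v}(G)}$ for any $a\in(0,1)$ (where $a^{\infty}=0$), and betweenness centrality $B_v=\sum_{s,t}\sigma_{st}(v)/\sigma_{st}$ (all on the class of all graphs), nor by closeness centrality $C_v=1/\sum_{u\ne v}\mathrm{dist}_{u,v}(G)$ on $\mathcal{SCG}$. Here the sum in $B_v$ runs over ordered pairs of distinct $s,t\in V\setminus\{v\}$ with $\sigma_{st}\neq 0$, $\sigma_{st}$ is the number of shortest paths from $s$ to $t$ (parallel edges giving different paths) and $\sigma_{st}(v)$ the number of those through $v$. Explicitly, let $G$ have three distinct nodes $u,v,w$, edges $(u,v),(w,v),(v,u),(v,w)$ and all weights $1$, and let $(G',b')=R_{u\to w}(G,b)$. Then $u,w$ are out-twins, both graphs are strongly connected, and the values at $v$ in $(G,b)$ and in $(G',b')$ are respectively $2$ and $1$ for $D$; $2$ and $1$ for $\beta$; $\tfrac12$ and $1$ for $C$; $2a$ and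 $a$ for $Y^a$, for every $a\in(0,1)$; and $2$ and $0$ for $B$. -/

import Mathlib

open scoped NNReal

noncomputable section

namespace CentralityAxioms

/-- A finite directed multigraph: a finite set of nodes and a multiset of ordered pairs of nodes.
Loops and repeated edges are allowed. -/
structure Multigraph (α : Type*) where
  nodes : Finset α
  edges : Multiset (α × α)
  fst_mem : ∀ e ∈ edges, e.1 ∈ nodes
  snd_mem : ∀ e ∈ edges, e.2 ∈ nodes

namespace Multigraph

variable {α : Type*} [DecidableEq α] (G : Multigraph α)

/-- The number of times the edge `(u, v)` appears. -/
def mult (u v : α) : ℕ := G.edges.count (u, v)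

/-- The multiset of outgoing edges of `v`. -/
def outEdges (v : α) : Multiset (α × α) := G.edges.filter fun e => e.1 = v

/-- The multiset of incoming edges of `v`. -/
def inEdges (v : α) : Multiset (α × α) := G.edges.filter fun e => e.2 = v

def outDegree (v : α) : ℕ := (G.outEdges v).card

/-- Distinct nodes with the same outgoing edges, counted with multiplicity. -/
def OutTwins (u w : α) : Prop :=
  u ∈ G.nodes ∧ w ∈ G.nodes ∧ u ≠ w ∧ ∀ t, G.mult u t = G.mult w t

/-- The graph obtained by redirecting `u` into `w`: delete `u` with all its incident edges, and for
every former edge `(v, u)` with `v ≠ u` add an edge `(v, w)`. -/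
def redirect (u w : α) (hw : w ∈ G.nodes) (huw : u ≠ w) : Multigraph α where
  nodes := G.nodes.erase u
  edges := (G.edges - G.outEdges u - G.inEdges u) +
    ((G.inEdges u).filter fun e => e.1 ≠ u).map fun e => (e.1, w)
  fst_mem := by
    intro e he
    rcases Multiset.mem_add.1 he with h | h
    · have h1 : e ∈ G.edges - G.outEdges u := Multiset.mem_of_le (Multiset.sub_le_self _ _) h
      rw [outEdges, Multiset.sub_filter_eq_filter_not, Multiset.mem_filter] at h1
      exact Finset.mem_erase.2 ⟨h1.2, G.fst_mem e h1.1⟩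
    · obtain ⟨f, hf, rfl⟩ := Multiset.mem_map.1 h
      have hf' := Multiset.mem_filter.1 hf
      exact Finset.mem_erase.2 ⟨hf'.2, G.fst_mem f (Multiset.mem_filter.1 hf'.1).1⟩
  snd_mem := by
    intro e he
    rcases Multiset.mem_add.1 he with h | h
    · have h1 : e ∈ G.edges - G.inEdges u := by
        rw [tsub_right_comm] at h
        exact Multiset.mem_of_le (Multiset.sub_le_self _ _) h
      rw [inEdges, Multiset.sub_filter_eq_filter_not, Multiset.mem_filter] at h1
      exact Finset.mem_erase.2 ⟨h1.2, G.snd_mem e h1.1⟩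
    · obtain ⟨f, hf, rfl⟩ := Multiset.mem_map.1 h
      exact Finset.mem_erase.2 ⟨huw.symm, hw⟩

/-- `p` lists the `k + 1` nodes of a path with `k ≥ 1` edges. -/
def IsPath (k : ℕ) (p : Fin (k + 1) → α) : Prop :=
  1 ≤ k ∧ ∀ i : Fin k, (p i.castSucc, p i.succ) ∈ G.edges

/-- There is a path with exactly `k` edges from `u` to `v`. -/
def HasPath (k : ℕ) (u v : α) : Prop :=
  ∃ p : Fin (k + 1) → α, G.IsPath k p ∧ p 0 = u ∧ p (Fin.last k) = v

/-- `v` is a successor of `u` (a node can be its own successor). -/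
def IsSuccessor (u v : α) : Prop := ∃ k, G.HasPath k u v

/-- The length of a shortest path from `u` to `v`, meaningful when `v` is a successor of `u`. -/
def dist (u v : α) : ℕ := sInf {k | G.HasPath k u v}

/-- Every node is a successor of every node, itself included. -/
def StronglyConnected : Prop :=
  G.nodes.Nonempty ∧ ∀ u ∈ G.nodes, ∀ v ∈ G.nodes, G.IsSuccessor u v

/-- The adjacency matrix, whose entry at `(u, v)` is the number of edges from `v` to `u`. -/
def adjMatrix : Matrix G.nodes G.nodes ℝ := Matrix.of fun u v => (G.mult v u : ℝ)

/-- The largest real eigenvalue of the adjacency matrix. -/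
def eigenMax : ℝ := sSup {c : ℝ | ∃ x : G.nodes → ℝ, x ≠ 0 ∧ G.adjMatrix.mulVec x = c • x}

/-- The class of graphs on which Katz and Bonacich centralities with decay factor `a` are defined. -/
def KatzClass (a : ℝ) : Prop := G.eigenMax < 1 / a

/-- The sequences of `k + 1` nodes of the graph that start in `s` and end in `t`. -/
def nodeSeqs (k : ℕ) (s t : α) : Finset (Fin (k + 1) → α) :=
  (Fintype.piFinset fun _ => G.nodes).filter fun p => p 0 = s ∧ p (Fin.last k) = t

/-- The number of paths with `k` edges from `s` to `t`. Parallel edges give different paths, so that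
a node sequence is counted as often as one can choose edges along it (never, if two consecutive
nodes are not joined by an edge). -/
def numPaths (k : ℕ) (s t : α) : ℕ :=
  ∑ p ∈ G.nodeSeqs k s t, ∏ i : Fin k, G.mult (p i.castSucc) (p i.succ)

/-- The number of paths with `k` edges from `s` to `t` that go through `v`. -/
def numPathsThrough (k : ℕ) (s t v : α) : ℕ :=
  ∑ p ∈ (G.nodeSeqs k s t).filter fun p => ∃ i, p i = v,
    ∏ i : Fin k, G.mult (p i.castSucc) (p i.succ)

/-- The number of shortest paths from `s` to `t`, for `s ≠ t`; it is `0` if there is no path. -/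
def numShortest (s t : α) : ℕ := G.numPaths (G.dist s t) s t

/-- The number of shortest paths from `s` to `t` that go through `v`, for `s ≠ t`. -/
def numShortestThrough (s t v : α) : ℕ := G.numPathsThrough (G.dist s t) s t v

end Multigraph

variable {α : Type*} [DecidableEq α]

/-- The weights after redirecting `u` into `w` (the value at the deleted node `u` is irrelevant). -/
def redirectWeights (b : α → ℝ≥0) (u w : α) : α → ℝ≥0 := Function.update b w (b u + b w)

/-- A centrality measure assigns a real number to a graph, node weights and a node of the graph.
Weights and values outside the set of nodes carry no meaning. -/
abbrev Centrality (α : Type*) := Multigraph α → (α → ℝ≥0) → α → ℝ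

/-- Node Redirect restricted to a class of graphs. -/
def NodeRedirectOn (C : Multigraph α → Prop) (F : Centrality α) : Prop :=
  ∀ (G : Multigraph α) (b : α → ℝ≥0) (u w : α) (h : G.OutTwins u w),
    C G → C (G.redirect u w h.2.1 h.2.2.1) →
      (∀ v ∈ G.nodes, v ≠ u → v ≠ w →
        F G b v = F (G.redirect u w h.2.1 h.2.2.1) (redirectWeights b u w) v) ∧
      F G b u + F G b w = F (G.redirect u w h.2.1 h.2.2.1) (redirectWeights b u w) w

/-- A system of conditions on a vector of values, depending on a weighted graph, has on every graph
of the class exactly one solution, and this solution is non-negative. -/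
def WellPosedOn (C : Multigraph α → Prop)
    (Sol : Multigraph α → (α → ℝ≥0) → (α → ℝ) → Prop) : Prop :=
  ∀ (G : Multigraph α) (b : α → ℝ≥0), C G →
    (∃! x, Sol G b x) ∧ ∀ x, Sol G b x → ∀ v ∈ G.nodes, 0 ≤ x v

/-! Measures given by a recursive system. A solution is a vector indexed by the nodes; here it is
extended by zero outside the set of nodes. -/

/-- The system that defines eigenvector centrality. -/
def IsEigenvector (G : Multigraph α) (_b : α → ℝ≥0) (x : α → ℝ) : Prop :=
  (∀ v ∈ G.nodes, x v = 1 / G.eigenMax * ((G.inEdges v).map fun e => x e.1).sum) ∧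
    ∑ v ∈ G.nodes, x v = 1 ∧ ∀ v ∉ G.nodes, x v = 0

/-- The system that defines Katz prestige. -/
def IsKatzPrestige (G : Multigraph α) (_b : α → ℝ≥0) (x : α → ℝ) : Prop :=
  (∀ v ∈ G.nodes, x v = ((G.inEdges v).map fun e => x e.1 / (G.outDegree e.1 : ℝ)).sum) ∧
    ∑ v ∈ G.nodes, x v = 1 ∧ ∀ v ∉ G.nodes, x v = 0

/-- The system that defines Katz centrality. -/
def IsKatz (a : ℝ) (G : Multigraph α) (b : α → ℝ≥0) (x : α → ℝ) : Prop :=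
  (∀ v ∈ G.nodes, x v = a * ((G.inEdges v).map fun e => x e.1).sum + (b v : ℝ)) ∧
    ∀ v ∉ G.nodes, x v = 0

/-- The system that defines Bonacich centrality. -/
def IsBonacich (a : ℝ) (G : Multigraph α) (b : α → ℝ≥0) (x : α → ℝ) : Prop :=
  (∀ v ∈ G.nodes, x v = ((G.inEdges v).map fun e => a * x e.1 + (b e.1 : ℝ)).sum) ∧
    ∀ v ∉ G.nodes, x v = 0

/-- The measure whose values are the solution of the given system. -/
def solutionOf (Sol : Multigraph α → (α → ℝ≥0) → (α → ℝ) → Prop) : Centrality α :=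
  fun G b => Classical.epsilon (Sol G b)

def eigenvectorCentrality : Centrality α := solutionOf IsEigenvector

def katzPrestige : Centrality α := solutionOf IsKatzPrestige

def katzCentrality (a : ℝ) : Centrality α := solutionOf (IsKatz a)

def bonacichCentrality (a : ℝ) : Centrality α := solutionOf (IsBonacich a)

/-! Measures given by explicit formulas. -/

def degreeCentrality : Centrality α := fun G _ v => ((G.inEdges v).card : ℝ)

def betaMeasure : Centrality α := fun G _ v =>
  ((G.inEdges v).map fun e => 1 / (G.outDegree e.1 : ℝ)).sum

/-- Considered on strongly connected graphs. -/
def closenessCentrality : Centrality α := fun G _ v =>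
  1 / ∑ u ∈ G.nodes.erase v, (G.dist u v : ℝ)

open Classical in
/-- Nodes from which `v` cannot be reached contribute zero. -/
def decayCentrality (a : ℝ) : Centrality α := fun G _ v =>
  ∑ u ∈ G.nodes.erase v, if G.IsSuccessor u v then a ^ G.dist u v else 0

/-- The sum ranges over the ordered pairs of distinct nodes `s`, `t` other than `v` such that there
is a path from `s` to `t`. -/
def betweennessCentrality : Centrality α := fun G _ v =>
  ∑ s ∈ G.nodes.erase v,
    ∑ t ∈ (G.nodes.erase v).filter fun t => s ≠ t ∧ G.numShortest s t ≠ 0,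
      (G.numShortestThrough s t v : ℝ) / (G.numShortest s t : ℝ)

/-- The graph with nodes `u`, `v`, `w` and edges `(u, v)`, `(w, v)`, `(v, u)`, `(v, w)`. -/
def exampleGraph (u v w : α) : Multigraph α where
  nodes := {u, v, w}
  edges := {(u, v), (w, v), (v, u), (v, w)}
  fst_mem := by simp
  snd_mem := by simp

theorem mem_exampleGraph (u v w : α) : w ∈ (exampleGraph u v w).nodes := by
  simp [exampleGraph]

end CentralityAxioms

end

/-! The four recursive systems are linear with a non-negative matrix, and redirecting `u` into `w`
acts on solutions by merging: `w` gets `x u + x w`. Out-twins send the same edges everywhere, so a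
remaining node other than `w` receives the same total as before, while `w` receives the totals of
`u` and `w` together (`sum_inEdges_redirect_of_ne`, `sum_inEdges_redirect_self`). The merged vector
therefore solves the new system, and uniqueness identifies it with the new centrality
(`nodeRedirectOn_solutionOf`). For eigenvector centrality the eigenvalue must also survive: the
merged vector is a non-negative eigenvector, and in the irreducible case only the largest eigenvalue
has one (`eq_sSup_realEigenvalues_of_nonneg`).

Well-posedness is Perron–Frobenius theory using real eigenvalues only. In
`exists_pos_smul_mulVec_lt`, while `1 - tA` stays invertible for `t` from `0` to `a`, the solution
of `(1 - tA) y = 1`, scaled by the determinant, stays positive. This settles Katz and Bonacich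
centrality; a compactness limit and irreducibility then give the Perron vector. For Katz prestige,
the absolute value of a fixed vector of a column-stochastic matrix is again fixed.

The other measures fail because merging two twins that point to `v` leaves `v` with one incoming
edge, and one other node, instead of two. -/

namespace CentralityAxioms

open Matrix

/-! ### Perron–Frobenius theory for non-negative real matrices -/

section NonnegativeMatrix

variable {V : Type*} [Fintype V] {A : Matrix V V ℝ}

theorem mulVec_le_mulVec_of_nonneg (hA : ∀ i j, 0 ≤ A i j) {x y : V → ℝ}
    (h : ∀ i, x i ≤ y i) (i : V) : (A *ᵥ x) i ≤ (A *ᵥ y) i :=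
  Finset.sum_le_sum fun j _ => mul_le_mul_of_nonneg_left (h j) (hA i j)

theorem mulVec_nonneg_of_nonneg (hA : ∀ i j, 0 ≤ A i j) {x : V → ℝ}
    (h : ∀ i, 0 ≤ x i) (i : V) : 0 ≤ (A *ᵥ x) i :=
  Finset.sum_nonneg fun j _ => mul_nonneg (hA i j) (h j)

/-- Every set of indices closed under the relation `0 < A v u` is empty or everything. -/
def IsStronglyConnectedMatrix (A : Matrix V V ℝ) : Prop :=
  ∀ S : V → Prop, (∀ u v, 0 < A v u → S u → S v) → ∀ u v, S u → S v

/-- The support of `x` is closed under edges: a positive `x u` with `0 < A v u` makes `(A x) v`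
positive, which `r * x v` could not bound if `x v` were zero. -/
theorem pos_of_mulVec_le (hA : ∀ i j, 0 ≤ A i j) (hirr : IsStronglyConnectedMatrix A) {r : ℝ}
    {x : V → ℝ} (hx : ∀ i, 0 ≤ x i) (hr : ∀ i, (A *ᵥ x) i ≤ r * x i) {k : V} (hk : 0 < x k)
    (i : V) : 0 < x i := by
  refine hirr (fun j => 0 < x j) (fun u v huv hu => ?_) k i hk
  refine lt_of_le_of_ne (hx v) fun h0 => ?_
  have h1 : A v u * x u ≤ (A *ᵥ x) v :=
    Finset.single_le_sum (f := fun j => A v j * x j)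
      (fun j _ => mul_nonneg (hA v j) (hx j)) (Finset.mem_univ u)
  have h2 := hr v
  rw [← h0, mul_zero] at h2
  linarith [mul_pos huv hu]

/-- For the least `c` with `z ≤ c • x`, the vector `c • x - z` is non-negative, subinvariant and
zero somewhere, so by `pos_of_mulVec_le` it is zero everywhere. The hypothesis `hpos` gives `0 ≤ c`,
so that scaling by `c` preserves the subinvariance of `x`. -/
theorem eq_smul_of_mulVec_eq [Nonempty V] (hA : ∀ i j, 0 ≤ A i j)
    (hirr : IsStronglyConnectedMatrix A) {r : ℝ} {x z : V → ℝ} (hx : ∀ i, 0 < x i)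
    (hr : ∀ i, (A *ᵥ x) i ≤ r * x i) (hz : A *ᵥ z = r • z) (hpos : ∃ i, 0 ≤ z i) :
    ∃ c : ℝ, 0 ≤ c ∧ z = c • x := by
  obtain ⟨k, -, hk⟩ := Finset.exists_max_image Finset.univ (fun j => z j / x j)
    Finset.univ_nonempty
  obtain ⟨i₀, hi₀⟩ := hpos
  refine ⟨z k / x k, (div_nonneg hi₀ (hx i₀).le).trans (hk i₀ (Finset.mem_univ _)), ?_⟩
  have hc : 0 ≤ z k / x k := (div_nonneg hi₀ (hx i₀).le).trans (hk i₀ (Finset.mem_univ _))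
  set c := z k / x k with hcdef
  have hwk : (c • x - z) k = 0 := by
    simp only [Pi.sub_apply, Pi.smul_apply, smul_eq_mul, hcdef]
    rw [div_mul_cancel₀ _ (hx k).ne', sub_self]
  have hw : ∀ i, 0 ≤ (c • x - z) i := fun i => by
    have := (div_le_iff₀ (hx i)).1 (hk i (Finset.mem_univ i))
    simpa using this
  have hrw : ∀ i, (A *ᵥ (c • x - z)) i ≤ r * (c • x - z) i := fun i => by
    rw [mulVec_sub, mulVec_smul, hz]
    simp only [Pi.sub_apply, Pi.smul_apply, smul_eq_mul]
    nlinarith [mul_le_mul_of_nonneg_left (hr i) hc]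
  ext i
  by_contra hne
  have hi : 0 < (c • x - z) i :=
    lt_of_le_of_ne (hw i) fun h0 => hne (by
      have : c * x i - z i = 0 := by simpa using h0.symm
      simp only [Pi.smul_apply, smul_eq_mul]; linarith)
  exact absurd hwk (pos_of_mulVec_le hA hirr hw hrw hi k).ne'

/-- Minimum principle: if the least ratio `c = y k / x k` were negative, then `a (A y) k ≥ c a (A x)
k > c x k = y k`, contradicting `hy`. Irreducibility plays no role, as the Katz class requires. -/
theorem nonneg_of_smul_mulVec_le (hA : ∀ i j, 0 ≤ A i j) {a : ℝ} (ha : 0 ≤ a) {x y : V → ℝ}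
    (hx : ∀ i, 0 < x i) (hax : ∀ i, a * (A *ᵥ x) i < x i) (hy : ∀ i, a * (A *ᵥ y) i ≤ y i)
    (i : V) : 0 ≤ y i := by
  obtain ⟨k, -, hk⟩ := Finset.exists_min_image Finset.univ (fun j => y j / x j)
    ⟨i, Finset.mem_univ i⟩
  set c := y k / x k with hc
  have hyk : y k = c * x k := by rw [hc, div_mul_cancel₀ _ (hx k).ne']
  have hle : ∀ j, (c • x) j ≤ y j := fun j => by
    have := (le_div_iff₀ (hx j)).1 (hk j (Finset.mem_univ j))
    simpa using this
  have hc0 : 0 ≤ c := by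
    by_contra! hneg
    have h1 := mulVec_le_mulVec_of_nonneg hA hle k
    rw [mulVec_smul, Pi.smul_apply, smul_eq_mul] at h1
    nlinarith [mul_le_mul_of_nonneg_left h1 ha, hy k, mul_lt_mul_of_neg_left (hax k) hneg]
  exact (mul_nonneg hc0 (hx i).le).trans (hle i)

/-- The real eigenvectors of an irreducible matrix form a positive ray up to sign, as soon as some
non-negative vector is subinvariant for the eigenvalue. -/
theorem existsUnique_of_subinvariant [Nonempty V] (hA : ∀ i j, 0 ≤ A i j)
    (hirr : IsStronglyConnectedMatrix A) {r : ℝ} {x z : V → ℝ} (hx : ∀ i, 0 ≤ x i)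
    (hx0 : x ≠ 0) (hr : ∀ i, (A *ᵥ x) i ≤ r * x i) (hz0 : z ≠ 0) (hz : A *ᵥ z = r • z) :
    (∃! y : V → ℝ, A *ᵥ y = r • y ∧ ∑ i, y i = 1) ∧
      ∀ y : V → ℝ, A *ᵥ y = r • y ∧ ∑ i, y i = 1 → ∀ i, 0 < y i := by
  obtain ⟨k, hk⟩ := Function.ne_iff.1 hx0
  have hpos : ∀ i, 0 < x i := pos_of_mulVec_le hA hirr hx hr (lt_of_le_of_ne (hx k) (Ne.symm hk))
  have hray : ∀ y : V → ℝ, A *ᵥ y = r • y → ∃ c : ℝ, y = c • x := by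
    intro y hy
    by_cases h : ∃ i, 0 ≤ y i
    · obtain ⟨c, -, hc⟩ := eq_smul_of_mulVec_eq hA hirr hpos hr hy h
      exact ⟨c, hc⟩
    · push Not at h
      obtain ⟨c, -, hc⟩ := eq_smul_of_mulVec_eq (z := -y) hA hirr hpos hr
        (by rw [mulVec_neg, hy, smul_neg]) ⟨Classical.arbitrary V, by simpa using (h _).le⟩
      exact ⟨-c, by rw [neg_smul, ← hc, neg_neg]⟩
  have hs : 0 < ∑ i, x i := Finset.sum_pos (fun i _ => hpos i) Finset.univ_nonempty
  -- The eigenvector `z` lies on the line of `x`, so the merely subinvariant `x` is itself an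
  -- eigenvector.
  obtain ⟨c, rfl⟩ := hray z hz
  have hc : c ≠ 0 := fun h => hz0 (by simp [h])
  have hxe : A *ᵥ x = r • x := by
    rw [mulVec_smul, smul_comm] at hz
    exact smul_right_injective _ hc hz
  have hy1 : ∀ y : V → ℝ, A *ᵥ y = r • y ∧ ∑ i, y i = 1 → y = (∑ i, x i)⁻¹ • x := by
    rintro y ⟨hy, hy'⟩
    obtain ⟨d, rfl⟩ := hray y hy
    simp only [Pi.smul_apply, smul_eq_mul, ← Finset.mul_sum] at hy'
    rw [eq_inv_of_mul_eq_one_left hy']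
  refine ⟨⟨(∑ i, x i)⁻¹ • x, ⟨by rw [mulVec_smul, hxe, smul_comm], ?_⟩, hy1⟩, fun y hy i => ?_⟩
  · simp only [Pi.smul_apply, smul_eq_mul, ← Finset.mul_sum]
    exact inv_mul_cancel₀ hs.ne'
  · rw [hy1 y hy]
    exact mul_pos (inv_pos.2 hs) (hpos i)

variable [DecidableEq V]

theorem det_one_sub_smul_ne_zero {t : ℝ}
    (h : ∀ x : V → ℝ, x = t • A *ᵥ x → x = 0) : (1 - t • A).det ≠ 0 := by
  intro h0
  obtain ⟨x, hx, hx'⟩ := Matrix.exists_mulVec_eq_zero_iff.2 h0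
  refine hx (h x ?_)
  rw [sub_mulVec, one_mulVec, smul_mulVec, sub_eq_zero] at hx'
  exact hx'

/-- If `1 / t` is not an eigenvalue for any `t ∈ (0, a]`, then `x ↦ x - a A x` attains a positive
value at some positive vector. -/
theorem exists_pos_smul_mulVec_lt (hA : ∀ i j, 0 ≤ A i j) {a : ℝ} (ha : 0 ≤ a)
    (h : ∀ t ∈ Set.Icc 0 a, ∀ x : V → ℝ, x = t • A *ᵥ x → x = 0) :
    ∃ x : V → ℝ, (∀ i, 0 < x i) ∧ ∀ i, a * (A *ᵥ x) i < x i := by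
  have hdc : Continuous fun t : ℝ => (1 - t • A).det := by fun_prop
  -- The determinant is `1` at `t = 0` and has no zero on the interval, so it cannot change sign.
  have hd : ∀ t ∈ Set.Icc 0 a, 0 < (1 - t • A).det := by
    intro t ht
    by_contra! hneg
    have h01 : (1 - (0 : ℝ) • A).det = 1 := by simp
    obtain ⟨s, hs, hs0⟩ := intermediate_value_Icc' ht.1 hdc.continuousOn
      (show (0 : ℝ) ∈ Set.Icc _ _ from ⟨hneg, by simp⟩)
    exact det_one_sub_smul_ne_zero (h s ⟨hs.1, hs.2.trans ht.2⟩) hs0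
  -- The adjugate replaces the inverse: `y t` is the determinant times the solution of `(1 - tA) y =
  -- 1`, and is visibly continuous in `t`.
  let y : ℝ → V → ℝ := fun t => (1 - t • A).adjugate *ᵥ 1
  have hyc : Continuous y := by
    have : Continuous fun t : ℝ => (1 - t • A).adjugate :=
      Continuous.matrix_adjugate (by fun_prop)
    exact this.matrix_mulVec continuous_const
  have hy : ∀ t i, y t i = (1 - t • A).det + t * (A *ᵥ y t) i := by
    intro t i
    have h1 : (1 - t • A) *ᵥ y t = (1 - t • A).det • 1 := by
      rw [mulVec_mulVec, mul_adjugate, smul_mulVec, one_mulVec]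
    have h2 := congrFun h1 i
    rw [sub_mulVec, one_mulVec, smul_mulVec] at h2
    simp only [Pi.sub_apply, Pi.smul_apply, smul_eq_mul, Pi.one_apply, mul_one] at h2
    linarith
  have hpos : ∀ t ∈ Set.Icc 0 a, (∀ i, 0 ≤ y t i) → ∀ i, (1 - t • A).det ≤ y t i := by
    intro t ht h0 i
    rw [hy t i]
    linarith [mul_nonneg ht.1 (mulVec_nonneg_of_nonneg hA h0 i)]
  -- Continuous induction on `t`: the condition is closed and holds at `0`, where `y` is constantly
  -- `1`. It is open to the right because `hpos` upgrades `0 ≤ y t` to a strictly positive lower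
  -- bound.
  have hsub : Set.Icc 0 a ⊆ {t | ∀ i, 0 ≤ y t i} := by
    refine IsClosed.Icc_subset_of_forall_mem_nhdsWithin ?_ ?_ ?_
    · refine IsClosed.inter ?_ isClosed_Icc
      rw [Set.ofPred_forall]
      exact isClosed_iInter fun i =>
        isClosed_le continuous_const ((continuous_apply i).comp hyc)
    · intro i
      simp [y]
    · rintro t ⟨ht, ht'⟩
      refine mem_nhdsWithin_of_mem_nhds ?_
      have hev : ∀ i, ∀ᶠ s in nhds t, 0 < y s i := fun i =>
        ((continuous_apply i).comp hyc).continuousAt.eventually_const_lt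
          ((hd t ⟨ht'.1, ht'.2.le⟩).trans_le (hpos t ⟨ht'.1, ht'.2.le⟩ ht i))
      filter_upwards [Filter.eventually_all.2 hev] with s hs i using (hs i).le
  have haa : a ∈ Set.Icc 0 a := ⟨ha, le_rfl⟩
  refine ⟨y a, fun i => (hd a haa).trans_le (hpos a haa (hsub haa) i), fun i => ?_⟩
  rw [hy a i]
  linarith [hd a haa]

/-- Existence, uniqueness and non-negativity for `x = a A x + b`. -/
theorem existsUnique_eq_smul_mulVec_add (hA : ∀ i j, 0 ≤ A i j) {a : ℝ} (ha : 0 ≤ a)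
    (h : ∀ t ∈ Set.Icc 0 a, ∀ x : V → ℝ, x = t • A *ᵥ x → x = 0) (b : V → ℝ)
    (hb : ∀ i, 0 ≤ b i) :
    (∃! x : V → ℝ, ∀ i, x i = a * (A *ᵥ x) i + b i) ∧
      ∀ x : V → ℝ, (∀ i, x i = a * (A *ᵥ x) i + b i) → ∀ i, 0 ≤ x i := by
  have hdet := det_one_sub_smul_ne_zero (h a ⟨ha, le_rfl⟩)
  obtain ⟨p, hp, hap⟩ := exists_pos_smul_mulVec_lt hA ha h
  refine ⟨⟨(1 - a • A)⁻¹ *ᵥ b, fun i => ?_, fun y hy => ?_⟩, fun x hx =>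
    nonneg_of_smul_mulVec_le hA ha hp hap fun i => by rw [hx i]; linarith [hb i]⟩
  · have h1 : (1 - a • A) *ᵥ ((1 - a • A)⁻¹ *ᵥ b) = b := by
      rw [mulVec_mulVec, mul_nonsing_inv _ hdet.isUnit, one_mulVec]
    have h2 := congrFun h1 i
    conv_lhs at h2 => rw [sub_mulVec, one_mulVec, smul_mulVec]
    simp only [Pi.sub_apply, Pi.smul_apply, smul_eq_mul] at h2
    linarith
  · have h1 : (1 - a • A) *ᵥ y = b := by
      ext i
      rw [sub_mulVec, one_mulVec, smul_mulVec]
      simp only [Pi.sub_apply, Pi.smul_apply, smul_eq_mul]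
      linarith [hy i]
    rw [← h1, mulVec_mulVec, nonsing_inv_mul _ hdet.isUnit, one_mulVec]

def realEigenvalues (A : Matrix V V ℝ) : Set ℝ :=
  {c : ℝ | ∃ x : V → ℝ, x ≠ 0 ∧ A.mulVec x = c • x}

/-- Finiteness makes the supremum of a nonempty set of eigenvalues a maximum. -/
theorem finite_realEigenvalues (A : Matrix V V ℝ) : (realEigenvalues A).Finite := by
  refine (Module.End.finite_hasEigenvalue (Matrix.toLin' A)).subset ?_
  rintro c ⟨x, hx, hc⟩
  exact Module.End.hasEigenvalue_of_hasEigenvector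
    (Module.End.hasEigenvector_iff.2 ⟨Module.End.mem_eigenspace_iff.2 (by simpa using hc), hx⟩)

theorem eq_zero_of_sSup_realEigenvalues_lt {a : ℝ} (h : sSup (realEigenvalues A) < 1 / a) :
    ∀ t ∈ Set.Icc 0 a, ∀ x : V → ℝ, x = t • A *ᵥ x → x = 0 := by
  intro t ht x hx
  by_contra hx0
  rcases ht.1.eq_or_lt with rfl | ht0
  · exact hx0 (by rw [hx, zero_smul])
  · have hmem : 1 / t ∈ realEigenvalues A := by
      refine ⟨x, hx0, ?_⟩
      conv_rhs => rw [hx]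
      rw [smul_smul, one_div, inv_mul_cancel₀ ht0.ne', one_smul]
    have h1 := le_csSup (finite_realEigenvalues A).bddAbove hmem
    have h2 : 1 / a ≤ 1 / t := one_div_le_one_div_of_le ht0 ht.2
    linarith

/-- Every `r` above the eigenvalues and `0` admits a positive vector with `A x < r x`; normalise
these vectors and let `r` decrease, using compactness of the simplex. The maximum with `0` keeps `1
/ r` meaningful before the supremum is known to be positive. -/
theorem exists_stdSimplex_mulVec_le [Nonempty V] (hA : ∀ i j, 0 ≤ A i j) :
    ∃ x ∈ stdSimplex ℝ V, ∀ i, (A *ᵥ x) i ≤ max (sSup (realEigenvalues A)) 0 * x i := by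
  set m := max (sSup (realEigenvalues A)) 0 with hm
  have hm0 : 0 ≤ m := le_max_right _ _
  have hstep : ∀ n : ℕ, ∃ x ∈ stdSimplex ℝ V, ∀ i, (A *ᵥ x) i ≤ (m + 1 / ((n : ℝ) + 1)) * x i := by
    intro n
    set r := m + 1 / ((n : ℝ) + 1) with hr
    have hmr : m < r := by have : 0 < 1 / ((n : ℝ) + 1) := by positivity
                           linarith
    have hr0 : 0 < r := hm0.trans_lt hmr
    obtain ⟨x, hx, hax⟩ := exists_pos_smul_mulVec_lt hA (one_div_nonneg.2 hr0.le)
      (eq_zero_of_sSup_realEigenvalues_lt (a := 1 / r)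
        (by rw [one_div_one_div]; exact (le_max_left _ _).trans_lt hmr))
    have hs : 0 < ∑ i, x i := Finset.sum_pos (fun i _ => hx i) Finset.univ_nonempty
    refine ⟨(∑ i, x i)⁻¹ • x, ⟨fun i => (mul_pos (inv_pos.2 hs) (hx i)).le, ?_⟩, fun i => ?_⟩
    · simp only [Pi.smul_apply, smul_eq_mul, ← Finset.mul_sum]
      exact inv_mul_cancel₀ hs.ne'
    · rw [mulVec_smul]
      simp only [Pi.smul_apply, smul_eq_mul]
      rw [mul_left_comm]
      refine mul_le_mul_of_nonneg_left ?_ (inv_pos.2 hs).le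
      have := (hax i).le
      rwa [one_div_mul_eq_div, div_le_iff₀' hr0] at this
  choose x hx hxle using hstep
  obtain ⟨y, hy, φ, hφ, hlim⟩ := (isCompact_stdSimplex ℝ V).tendsto_subseq hx
  refine ⟨y, hy, fun i => ?_⟩
  have h1 : Filter.Tendsto (fun n => (A *ᵥ x (φ n)) i) Filter.atTop (nhds ((A *ᵥ y) i)) := by
    have hc : Continuous fun z : V → ℝ => (A *ᵥ z) i := by fun_prop
    exact (hc.tendsto y).comp hlim
  have h2 : Filter.Tendsto (fun n => (m + 1 / ((φ n : ℝ) + 1)) * x (φ n) i) Filter.atTop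
      (nhds ((m + 0) * y i)) :=
    (tendsto_const_nhds.add
      (tendsto_one_div_add_atTop_nhds_zero_nat.comp hφ.tendsto_atTop)).mul
      (((continuous_apply i).tendsto y).comp hlim)
  rw [add_zero] at h2
  exact le_of_tendsto_of_tendsto' h1 h2 fun n => hxle (φ n) i

/-- The Perron–Frobenius theorem for irreducible matrices. -/
theorem perron_frobenius [Nonempty V] (hA : ∀ i j, 0 ≤ A i j)
    (hirr : IsStronglyConnectedMatrix A) (hA0 : A ≠ 0) :
    0 < sSup (realEigenvalues A) ∧
      (∃! y : V → ℝ, A *ᵥ y = sSup (realEigenvalues A) • y ∧ ∑ i, y i = 1) ∧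
      ∀ y : V → ℝ, A *ᵥ y = sSup (realEigenvalues A) • y ∧ ∑ i, y i = 1 → ∀ i, 0 < y i := by
  obtain ⟨x, hx, hxle⟩ := exists_stdSimplex_mulVec_le hA
  have hx0 : x ≠ 0 := by
    rintro rfl
    simpa using hx.2
  -- Otherwise `A x ≤ 0` for a positive `x`, which forces `A = 0`.
  have hpos : 0 < sSup (realEigenvalues A) := by
    by_contra! hneg
    rw [max_eq_right hneg] at hxle
    obtain ⟨k, hk⟩ := Function.ne_iff.1 hx0
    have hxp := pos_of_mulVec_le hA hirr hx.1 hxle (lt_of_le_of_ne (hx.1 k) (Ne.symm hk))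
    refine hA0 ?_
    ext i j
    refine le_antisymm ?_ (hA i j)
    have h1 : A i j * x j ≤ (A *ᵥ x) i :=
      Finset.single_le_sum (f := fun j => A i j * x j)
        (fun j _ => mul_nonneg (hA i j) (hx.1 j)) (Finset.mem_univ j)
    have h2 := hxle i
    by_contra! h3
    have h4 : 0 < A i j := h3
    nlinarith [mul_pos h4 (hxp j)]
  rw [max_eq_left hpos.le] at hxle
  -- The supremum of the empty set is `0` by convention, so positivity proves that a real eigenvalue
  -- exists.
  have hne : (realEigenvalues A).Nonempty := by
    by_contra h
    rw [Set.not_nonempty_iff_eq_empty.1 h, Real.sSup_empty] at hpos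
    exact hpos.false
  obtain ⟨z, hz0, hz⟩ := hne.csSup_mem (finite_realEigenvalues A)
  exact ⟨hpos, existsUnique_of_subinvariant hA hirr hx.1 hx0 hxle hz0 hz⟩

/-- Compare `x` with the Perron vector `z` of the largest eigenvalue `m`: where `z / x` is maximal,
`m z k = (A z) k ≤ (z k / x k) (A x) k = c z k`, so `m ≤ c`. -/
theorem eq_sSup_realEigenvalues_of_nonneg [Nonempty V] (hA : ∀ i j, 0 ≤ A i j)
    (hirr : IsStronglyConnectedMatrix A) (hA0 : A ≠ 0) {c : ℝ} {x : V → ℝ}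
    (hx : ∀ i, 0 ≤ x i) (hx0 : x ≠ 0) (hc : A *ᵥ x = c • x) :
    c = sSup (realEigenvalues A) := by
  refine le_antisymm (le_csSup (finite_realEigenvalues A).bddAbove ⟨x, hx0, hc⟩) ?_
  obtain ⟨-, ⟨z, ⟨hz, hz1⟩, -⟩, hzpos⟩ := perron_frobenius hA hirr hA0
  have hzp := hzpos z ⟨hz, hz1⟩
  obtain ⟨k₀, hk₀⟩ := Function.ne_iff.1 hx0
  have hxp := pos_of_mulVec_le hA hirr hx (fun i => (congrFun hc i).le)
    (lt_of_le_of_ne (hx k₀) (Ne.symm hk₀))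
  obtain ⟨k, -, hk⟩ := Finset.exists_max_image Finset.univ (fun j => z j / x j)
    Finset.univ_nonempty
  have hle : ∀ i, z i ≤ ((z k / x k) • x) i := fun i =>
    (div_le_iff₀ (hxp i)).1 (hk i (Finset.mem_univ i))
  have h1 := mulVec_le_mulVec_of_nonneg hA hle k
  rw [hz, mulVec_smul, hc] at h1
  simp only [Pi.smul_apply, smul_eq_mul] at h1
  rw [mul_left_comm, div_mul_cancel₀ _ (hxp k).ne'] at h1
  exact le_of_mul_le_mul_right h1 (hzp k)

/-- Stationary vectors of an irreducible column-stochastic matrix. -/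
theorem existsUnique_stationary [Nonempty V] (hA : ∀ i j, 0 ≤ A i j)
    (hirr : IsStronglyConnectedMatrix A) (hcol : ∀ j, ∑ i, A i j = 1) :
    (∃! y : V → ℝ, A *ᵥ y = y ∧ ∑ i, y i = 1) ∧
      ∀ y : V → ℝ, A *ᵥ y = y ∧ ∑ i, y i = 1 → ∀ i, 0 < y i := by
  -- The all-ones row vector is a left null vector, since the columns sum to one.
  have hdet : (A - 1).det = 0 := by
    refine Matrix.exists_vecMul_eq_zero_iff.1 ⟨1, one_ne_zero, ?_⟩
    ext j
    rw [vecMul_sub, vecMul_one]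
    simp [vecMul, dotProduct, hcol]
  obtain ⟨z, hz0, hz⟩ := Matrix.exists_mulVec_eq_zero_iff.2 hdet
  rw [sub_mulVec, one_mulVec, sub_eq_zero] at hz
  -- The triangle inequality gives `|z| ≤ A |z|`; the column sums make both sides have equal totals,
  -- so equality holds in every entry.
  have habs : ∀ i, |z| i ≤ (A *ᵥ |z|) i := fun i => by
    calc |z i| = |(A *ᵥ z) i| := by rw [hz]
      _ ≤ ∑ j, |A i j * z j| := Finset.abs_sum_le_sum_abs _ _
      _ = (A *ᵥ |z|) i := Finset.sum_congr rfl fun j _ => by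
        rw [abs_mul, abs_of_nonneg (hA i j), Pi.abs_apply]
  have hsum : ∑ i, (A *ᵥ |z|) i = ∑ i, |z| i := by
    simp only [mulVec, dotProduct]
    rw [Finset.sum_comm]
    simp only [← Finset.sum_mul, hcol, one_mul]
  have heq : ∀ i, |z| i = (A *ᵥ |z|) i := fun i =>
    (Finset.sum_eq_sum_iff_of_le fun i _ => habs i).1 hsum.symm i (Finset.mem_univ i)
  have := existsUnique_of_subinvariant (r := 1) hA hirr (x := |z|) (fun i => abs_nonneg _)
    (by simpa using hz0) (fun i => by rw [one_mul, heq i]) hz0 (by rw [hz, one_smul])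
  simpa only [one_smul] using this

end NonnegativeMatrix

end CentralityAxioms

/-! ### Edge sums, redirecting, and the matrices of a graph -/

namespace CentralityAxioms

open Matrix

variable {α : Type*}

theorem solutionOf_spec {C : Multigraph α → Prop}
    {Sol : Multigraph α → (α → ℝ≥0) → (α → ℝ) → Prop} (h : WellPosedOn C Sol) {G : Multigraph α}
    (hG : C G) (b : α → ℝ≥0) : Sol G b (solutionOf Sol G b) :=
  Classical.epsilon_spec (h G b hG).1.exists

namespace Multigraph

variable {G : Multigraph α}

/-- Take the first edge of a path from `u` to itself, which exists because paths have positive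
length. -/
theorem StronglyConnected.exists_edge (hG : G.StronglyConnected) {u : α} (hu : u ∈ G.nodes) :
    ∃ v ∈ G.nodes, (u, v) ∈ G.edges := by
  obtain ⟨k, p, ⟨hk, hp⟩, h0, -⟩ := hG.2 u hu u hu
  have := hp ⟨0, hk⟩
  refine ⟨_, G.snd_mem _ this, ?_⟩
  convert! this using 2
  exact h0.symm

/-- A closed set propagates along paths. Only positivity on edges matters, so the adjacency and the
random-walk matrix are both covered. -/
theorem StronglyConnected.isStronglyConnectedMatrix (hG : G.StronglyConnected)
    {A : Matrix G.nodes G.nodes ℝ} (hA : ∀ u v : G.nodes, ((u : α), (v : α)) ∈ G.edges → 0 < A v u) :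
    IsStronglyConnectedMatrix A := by
  intro S hS u v hu
  obtain ⟨k, p, ⟨hk, hp⟩, h0, hl⟩ := hG.2 u u.2 v v.2
  have hmain : ∀ i : Fin (k + 1), ∃ hi : p i ∈ G.nodes, S ⟨p i, hi⟩ := by
    intro i
    induction i using Fin.induction with
    | zero => exact ⟨by rw [h0]; exact u.2, by convert hu⟩
    | succ i ih =>
      obtain ⟨hi, hSi⟩ := ih
      exact ⟨G.snd_mem _ (hp i), hS _ _ (hA ⟨_, hi⟩ ⟨_, G.snd_mem _ (hp i)⟩ (hp i)) hSi⟩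
  obtain ⟨hv, hSv⟩ := hmain (Fin.last k)
  convert hSv
  exact hl.symm

theorem sum_nodes_eq (f : α → ℝ) : ∑ i : G.nodes, f i = ∑ v ∈ G.nodes, f v :=
  Finset.sum_coe_sort G.nodes f

variable [DecidableEq α]

theorem sum_map_filter_snd {s : Multiset (α × α)} {N : Finset α} (hs : ∀ e ∈ s, e.1 ∈ N)
    (f : α → ℝ) (v : α) :
    ((s.filter fun e => e.2 = v).map fun e => f e.1).sum = ∑ t ∈ N, (s.count (t, v) : ℝ) * f t := by
  induction s using Multiset.induction_on with
  | empty => simp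
  | cons e s ih =>
    have he := hs e (Multiset.mem_cons_self e s)
    have ih' := ih fun e' h => hs e' (Multiset.mem_cons_of_mem h)
    obtain ⟨x, y⟩ := e
    by_cases hy : y = v
    · subst hy
      rw [Multiset.filter_cons_of_pos (p := fun e : α × α => e.2 = y) s rfl, Multiset.map_cons, Multiset.sum_cons, ih']
      simp only [Multiset.count_cons, Prod.mk.injEq, and_true, Nat.cast_add, add_mul,
        Finset.sum_add_distrib, Nat.cast_ite, Nat.cast_one, Nat.cast_zero, ite_mul, one_mul,
        zero_mul, Finset.sum_ite_eq', if_pos he]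
      ring
    · rw [Multiset.filter_cons_of_neg _ (by simpa using hy), ih']
      refine Finset.sum_congr rfl fun t _ => ?_
      rw [Multiset.count_cons_of_ne fun h => hy (Prod.ext_iff.1 h).2.symm]

theorem card_filter_fst {s : Multiset (α × α)} {N : Finset α} (hs : ∀ e ∈ s, e.2 ∈ N) (u : α) :
    (s.filter fun e => e.1 = u).card = ∑ t ∈ N, s.count (u, t) := by
  induction s using Multiset.induction_on with
  | empty => simp
  | cons e s ih =>
    have he := hs e (Multiset.mem_cons_self e s)
    have ih' := ih fun e' h => hs e' (Multiset.mem_cons_of_mem h)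
    obtain ⟨x, y⟩ := e
    by_cases hx : x = u
    · subst hx
      rw [Multiset.filter_cons_of_pos (p := fun e : α × α => e.1 = x) s rfl, Multiset.card_cons, ih']
      simp only [Multiset.count_cons, Prod.mk.injEq, true_and, Finset.sum_add_distrib,
        Finset.sum_ite_eq', if_pos he]
    · rw [Multiset.filter_cons_of_neg _ (by simpa using hx), ih']
      refine Finset.sum_congr rfl fun t _ => ?_
      rw [Multiset.count_cons_of_ne fun h => hx (Prod.ext_iff.1 h).1.symm]

variable (G)

theorem sum_map_inEdges (f : α → ℝ) (v : α) :
    ((G.inEdges v).map fun e => f e.1).sum = ∑ t ∈ G.nodes, (G.mult t v : ℝ) * f t :=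
  sum_map_filter_snd G.fst_mem f v

theorem outDegree_eq_sum (u : α) : G.outDegree u = ∑ t ∈ G.nodes, G.mult u t :=
  card_filter_fst G.snd_mem u

theorem mult_redirect {u w : α} (hw : w ∈ G.nodes) (huw : u ≠ w) {t v : α} (ht : t ≠ u)
    (hv : v ≠ u) :
    (G.redirect u w hw huw).mult t v = G.mult t v + if v = w then G.mult t u else 0 := by
  have h1 : (((G.inEdges u).filter fun e => e.1 ≠ u).map fun e => (e.1, w)).count (t, v) =
      if v = w then G.mult t u else 0 := by
    rw [Multiset.count_map, inEdges, Multiset.filter_filter, Multiset.filter_filter]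
    split_ifs with h
    · subst h
      rw [mult, Multiset.count_eq_card_filter_eq]
      refine congrArg _ (Multiset.filter_congr fun e _ => ?_)
      constructor
      · rintro ⟨⟨h1, -⟩, h3⟩
        exact Prod.ext (Prod.ext_iff.1 h1).1 h3.symm
      · rintro rfl
        exact ⟨⟨rfl, ht⟩, rfl⟩
    · rw [Multiset.card_eq_zero, Multiset.filter_eq_nil]
      rintro e - ⟨⟨h1, -⟩, -⟩
      exact h (Prod.ext_iff.1 h1).2
  have h2 : (G.edges - G.outEdges u - G.inEdges u).count (t, v) = G.mult t v := by
    rw [Multiset.count_sub, Multiset.count_sub, outEdges, inEdges,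
      Multiset.count_filter_of_neg (by simpa using ht),
      Multiset.count_filter_of_neg (by simpa using hv), mult, tsub_zero, tsub_zero]
  rw [mult, redirect, Multiset.count_add, h1, h2]

variable {G}

/-- Merging the terms at `u` and `w` preserves a sum; this serves out-degrees, incoming totals and
the normalisation alike. -/
theorem sum_erase_eq_sum {M : Type*} [AddCommMonoid M] {N : Finset α} {u w : α} (hu : u ∈ N)
    (hw : w ∈ N) (huw : u ≠ w) {g g' : α → M} (h : ∀ t ∈ N, t ≠ u → t ≠ w → g' t = g t)
    (h' : g' w = g u + g w) : ∑ t ∈ N.erase u, g' t = ∑ t ∈ N, g t := by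
  have hw' : w ∈ N.erase u := Finset.mem_erase.2 ⟨huw.symm, hw⟩
  rw [← Finset.add_sum_erase _ g' hw', ← Finset.add_sum_erase _ g hu,
    ← Finset.add_sum_erase _ g hw', h', add_assoc]
  congr 2
  refine Finset.sum_congr rfl fun t ht => ?_
  simp only [Finset.mem_erase] at ht
  exact h t ht.2.2 ht.2.1 ht.1

theorem outDegree_redirect {u w : α} (h : G.OutTwins u w) {t : α} (ht : t ≠ u) :
    (G.redirect u w h.2.1 h.2.2.1).outDegree t = G.outDegree t := by
  rw [outDegree_eq_sum, outDegree_eq_sum]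
  refine sum_erase_eq_sum h.1 h.2.1 h.2.2.1 (fun v _ hvu hvw => ?_) ?_
  · rw [mult_redirect G _ _ ht hvu, if_neg hvw, add_zero]
  · rw [mult_redirect G _ _ ht h.2.2.1.symm, if_pos rfl, add_comm]

theorem OutTwins.outDegree_eq {u w : α} (h : G.OutTwins u w) : G.outDegree u = G.outDegree w := by
  rw [outDegree_eq_sum, outDegree_eq_sum]
  exact Finset.sum_congr rfl fun t _ => h.2.2.2 t

/-- The edges from `w` now carry `f u + f w`, and twins have equal multiplicities into `v`, so
nothing is lost with `u`. The function `f` is whatever a node sends along each edge: a value, a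
value over the out-degree, or `a * x + b`. -/
theorem sum_inEdges_redirect_of_ne {u w : α} (h : G.OutTwins u w) {f f' : α → ℝ}
    (hf : ∀ t ∈ G.nodes, t ≠ u → t ≠ w → f' t = f t) (hfw : f' w = f u + f w)
    {v : α} (hvu : v ≠ u) (hvw : v ≠ w) :
    (((G.redirect u w h.2.1 h.2.2.1).inEdges v).map fun e => f' e.1).sum =
      ((G.inEdges v).map fun e => f e.1).sum := by
  rw [sum_map_inEdges, sum_map_inEdges]
  refine sum_erase_eq_sum h.1 h.2.1 h.2.2.1 (fun t ht htu htw => ?_) ?_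
  · rw [mult_redirect G _ _ htu hvu, if_neg hvw, add_zero, hf t ht htu htw]
  · rw [mult_redirect G _ _ h.2.2.1.symm hvu, if_neg hvw, add_zero, hfw, h.2.2.2 v, mul_add]

/-- Edges into `u` and into `w` both end at `w` now. Loops and edges between the twins fit too: the
new loops at `w` number `mult w w + mult w u`, which also equals `mult u w + mult u u`. -/
theorem sum_inEdges_redirect_self {u w : α} (h : G.OutTwins u w) {f f' : α → ℝ}
    (hf : ∀ t ∈ G.nodes, t ≠ u → t ≠ w → f' t = f t) (hfw : f' w = f u + f w) :
    (((G.redirect u w h.2.1 h.2.2.1).inEdges w).map fun e => f' e.1).sum =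
      ((G.inEdges u).map fun e => f e.1).sum + ((G.inEdges w).map fun e => f e.1).sum := by
  rw [sum_map_inEdges, sum_map_inEdges, sum_map_inEdges, ← Finset.sum_add_distrib]
  refine sum_erase_eq_sum h.1 h.2.1 h.2.2.1 (fun t ht htu htw => ?_) ?_
  · rw [mult_redirect G _ _ htu h.2.2.1.symm, if_pos rfl, hf t ht htu htw]
    push_cast
    ring
  · rw [mult_redirect G _ _ h.2.2.1.symm h.2.2.1.symm, if_pos rfl, hfw, h.2.2.2 w, h.2.2.2 u]
    push_cast
    ring

theorem adjMatrix_nonneg (i j : G.nodes) : 0 ≤ G.adjMatrix i j := Nat.cast_nonneg _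

theorem adjMatrix_mulVec (x : α → ℝ) (v : G.nodes) :
    (G.adjMatrix *ᵥ fun i => x i) v = ((G.inEdges v).map fun e => x e.1).sum := by
  rw [sum_map_inEdges, ← sum_nodes_eq]
  rfl

theorem StronglyConnected.adjMatrix (hG : G.StronglyConnected) :
    IsStronglyConnectedMatrix G.adjMatrix :=
  hG.isStronglyConnectedMatrix fun _ _ h =>
    Nat.cast_pos.2 (Multiset.count_pos.2 h)

theorem StronglyConnected.adjMatrix_ne_zero (hG : G.StronglyConnected) : G.adjMatrix ≠ 0 := by
  obtain ⟨u, hu⟩ := hG.1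
  obtain ⟨v, hv, huv⟩ := hG.exists_edge hu
  intro h
  have h1 : (G.mult u v : ℝ) = 0 := congrFun (congrFun h ⟨v, hv⟩) ⟨u, hu⟩
  exact (Multiset.count_pos.2 huv).ne' (Nat.cast_eq_zero.1 h1)

theorem StronglyConnected.eigenMax_pos (hG : G.StronglyConnected) : 0 < G.eigenMax :=
  have := hG.1.to_subtype
  (perron_frobenius adjMatrix_nonneg hG.adjMatrix hG.adjMatrix_ne_zero).1

/-- Entry `(v, u)` is the probability that a random walk moves from `u` to `v`. -/
noncomputable def walkMatrix (G : Multigraph α) : Matrix G.nodes G.nodes ℝ :=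
  Matrix.of fun v u => (G.mult u v : ℝ) / (G.outDegree u : ℝ)

theorem walkMatrix_nonneg (i j : G.nodes) : 0 ≤ G.walkMatrix i j :=
  div_nonneg (Nat.cast_nonneg _) (Nat.cast_nonneg _)

theorem walkMatrix_mulVec (x : α → ℝ) (v : G.nodes) :
    (G.walkMatrix *ᵥ fun i => x i) v =
      ((G.inEdges v).map fun e => x e.1 / (G.outDegree e.1 : ℝ)).sum := by
  rw [sum_map_inEdges G (fun t => x t / (G.outDegree t : ℝ)), ← sum_nodes_eq]
  exact Finset.sum_congr rfl fun t _ => div_mul_eq_mul_div₀ _ _ _ |>.trans (mul_div_assoc _ _ _)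

theorem StronglyConnected.outDegree_pos (hG : G.StronglyConnected) {u : α} (hu : u ∈ G.nodes) :
    0 < G.outDegree u := by
  obtain ⟨v, -, huv⟩ := hG.exists_edge hu
  exact Multiset.card_pos_iff_exists_mem.2 ⟨(u, v), Multiset.mem_filter.2 ⟨huv, rfl⟩⟩

theorem StronglyConnected.walkMatrix (hG : G.StronglyConnected) :
    IsStronglyConnectedMatrix G.walkMatrix :=
  hG.isStronglyConnectedMatrix fun u _ h =>
    div_pos (Nat.cast_pos.2 (Multiset.count_pos.2 h)) (Nat.cast_pos.2 (hG.outDegree_pos u.2))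

theorem StronglyConnected.sum_walkMatrix (hG : G.StronglyConnected) (j : G.nodes) :
    ∑ i, G.walkMatrix i j = 1 := by
  have h : ∑ i, G.walkMatrix i j = ∑ v ∈ G.nodes, (G.mult j v : ℝ) / (G.outDegree j : ℝ) :=
    sum_nodes_eq fun v => (G.mult j v : ℝ) / (G.outDegree j : ℝ)
  rw [h, ← Finset.sum_div, ← Nat.cast_sum, ← outDegree_eq_sum,
    div_self (Nat.cast_ne_zero.2 (hG.outDegree_pos j.2).ne')]

end Multigraph

/-! ### Well-posedness of the four systems -/

open Multigraph

variable [DecidableEq α]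

/-- Extension by zero identifies vectors indexed by the nodes with functions vanishing off them,
which carries the matrix results over. -/
theorem existsUnique_of_restrict {N : Finset α} {P : (α → ℝ) → Prop} {Q : (N → ℝ) → Prop}
    (h : ∀ x, P x ↔ Q (fun i => x i) ∧ ∀ v ∉ N, x v = 0)
    (hQ : (∃! y, Q y) ∧ ∀ y, Q y → ∀ i, 0 ≤ y i) :
    (∃! x, P x) ∧ ∀ x, P x → ∀ v ∈ N, 0 ≤ x v := by
  obtain ⟨⟨y, hy, huniq⟩, hnn⟩ := hQ
  refine ⟨⟨fun v => if hv : v ∈ N then y ⟨v, hv⟩ else 0, (h _).2 ⟨?_, fun v hv => dif_neg hv⟩,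
    fun x hx => ?_⟩, fun x hx v hv => hnn _ ((h x).1 hx).1 ⟨v, hv⟩⟩
  · simpa using hy
  · obtain ⟨hx1, hx2⟩ := (h x).1 hx
    ext v
    split_ifs with hv
    · exact congrFun (huniq _ hx1) ⟨v, hv⟩
    · exact hx2 v hv

theorem wellPosedOn_isEigenvector :
    WellPosedOn (α := α) StronglyConnected IsEigenvector := by
  intro G b hG
  have := hG.1.to_subtype
  have hpos := hG.eigenMax_pos
  obtain ⟨-, h1, h2⟩ := perron_frobenius adjMatrix_nonneg hG.adjMatrix hG.adjMatrix_ne_zero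
  refine existsUnique_of_restrict (fun x => ?_) ⟨h1, fun y hy i => (h2 y hy i).le⟩
  rw [IsEigenvector, ← and_assoc, sum_nodes_eq, funext_iff, Subtype.forall]
  refine and_congr_left' (and_congr_left' (forall₂_congr fun v hv => ?_))
  rw [adjMatrix_mulVec x ⟨v, hv⟩, one_div, eq_inv_mul_iff_mul_eq₀ hpos.ne', eq_comm]
  rfl

theorem wellPosedOn_isKatzPrestige :
    WellPosedOn (α := α) StronglyConnected IsKatzPrestige := by
  intro G b hG
  have := hG.1.to_subtype
  obtain ⟨h1, h2⟩ := existsUnique_stationary walkMatrix_nonneg hG.walkMatrix hG.sum_walkMatrix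
  refine existsUnique_of_restrict (fun x => ?_) ⟨h1, fun y hy i => (h2 y hy i).le⟩
  rw [IsKatzPrestige, ← and_assoc, sum_nodes_eq, funext_iff, Subtype.forall]
  refine and_congr_left' (and_congr_left' (forall₂_congr fun v hv => ?_))
  rw [walkMatrix_mulVec x ⟨v, hv⟩, eq_comm]

theorem wellPosedOn_isKatz {a : ℝ} (ha : 0 ≤ a) :
    WellPosedOn (α := α) (fun G => G.KatzClass a) (IsKatz a) := by
  intro G b hG
  refine existsUnique_of_restrict (fun x => ?_) (existsUnique_eq_smul_mulVec_add
    adjMatrix_nonneg ha (eq_zero_of_sSup_realEigenvalues_lt hG) (fun i : G.nodes => (b i : ℝ))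
    fun i => NNReal.coe_nonneg _)
  rw [IsKatz, Subtype.forall]
  refine and_congr_left' (forall₂_congr fun v hv => ?_)
  rw [adjMatrix_mulVec x ⟨v, hv⟩]

theorem wellPosedOn_isBonacich {a : ℝ} (ha : 0 ≤ a) :
    WellPosedOn (α := α) (fun G => G.KatzClass a) (IsBonacich a) := by
  intro G b hG
  refine existsUnique_of_restrict (fun x => ?_) (existsUnique_eq_smul_mulVec_add
    adjMatrix_nonneg ha (eq_zero_of_sSup_realEigenvalues_lt hG)
    -- Bonacich centrality solves the Katz equation whose inhomogeneous term is the total weight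
    -- arriving along incoming edges.
    (fun i : G.nodes => ((G.inEdges i).map fun e => (b e.1 : ℝ)).sum)
    fun i => Multiset.sum_nonneg fun r hr => ?_)
  · rw [IsBonacich, Subtype.forall]
    refine and_congr_left' (forall₂_congr fun v hv => ?_)
    rw [adjMatrix_mulVec x ⟨v, hv⟩, Multiset.sum_map_add, Multiset.sum_map_mul_left]
  · obtain ⟨e, -, rfl⟩ := Multiset.mem_map.1 hr
    exact NNReal.coe_nonneg _

/-! ### Node Redirect for the four recursive centralities -/

/-- The values after redirecting `u` into `w`. -/
noncomputable def redirectValues (x : α → ℝ) (u w : α) : α → ℝ :=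
  Function.update (Function.update x w (x u + x w)) u 0

section RedirectValues

variable {x : α → ℝ} {u w : α}

theorem redirectValues_left : redirectValues x u w u = 0 := Function.update_self ..

theorem redirectValues_right (huw : u ≠ w) : redirectValues x u w w = x u + x w := by
  rw [redirectValues, Function.update_of_ne huw.symm, Function.update_self]

theorem redirectValues_of_ne {t : α} (htu : t ≠ u) (htw : t ≠ w) :
    redirectValues x u w t = x t := by
  rw [redirectValues, Function.update_of_ne htu, Function.update_of_ne htw]

theorem redirectWeights_right {b : α → ℝ≥0} : redirectWeights b u w w = b u + b w :=
  Function.update_self ..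

theorem redirectWeights_of_ne {b : α → ℝ≥0} {t : α} (htw : t ≠ w) :
    redirectWeights b u w t = b t := Function.update_of_ne htw ..

theorem redirectValues_eq_zero {G : Multigraph α} (h : G.OutTwins u w)
    (hx : ∀ v ∉ G.nodes, x v = 0) :
    ∀ v ∉ (G.redirect u w h.2.1 h.2.2.1).nodes, redirectValues x u w v = 0 := by
  intro v hv
  by_cases hvu : v = u
  · rw [hvu, redirectValues_left]
  · have hv' : v ∉ G.nodes := fun h' => hv (Finset.mem_erase.2 ⟨hvu, h'⟩)
    rw [redirectValues_of_ne hvu fun hvw => hv' (hvw ▸ h.2.1), hx v hv']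

theorem sum_redirectValues {G : Multigraph α} (h : G.OutTwins u w) :
    ∑ v ∈ (G.redirect u w h.2.1 h.2.2.1).nodes, redirectValues x u w v = ∑ v ∈ G.nodes, x v :=
  sum_erase_eq_sum h.1 h.2.1 h.2.2.1 (fun _ _ hu hw => redirectValues_of_ne hu hw)
    (redirectValues_right h.2.2.1)

theorem forall_mem_redirect {G : Multigraph α} (h : G.OutTwins u w) {P : α → Prop} (hw : P w)
    (hP : ∀ v ∈ G.nodes, v ≠ u → v ≠ w → P v) :
    ∀ v ∈ (G.redirect u w h.2.1 h.2.2.1).nodes, P v := by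
  intro v hv
  obtain ⟨hvu, hv'⟩ := Finset.mem_erase.1 hv
  by_cases hvw : v = w
  · exact hvw ▸ hw
  · exact hP v hv' hvu hvw

theorem redirectValues_nonneg {G : Multigraph α} (h : G.OutTwins u w)
    (hx : ∀ v ∈ G.nodes, 0 ≤ x v) :
    ∀ v ∈ (G.redirect u w h.2.1 h.2.2.1).nodes, 0 ≤ redirectValues x u w v :=
  forall_mem_redirect h
    (by rw [redirectValues_right h.2.2.1]; exact add_nonneg (hx u h.1) (hx w h.2.1))
    fun v hv hvu hvw => by rw [redirectValues_of_ne hvu hvw]; exact hx v hv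

end RedirectValues

/-- By uniqueness on the redirected graph, it suffices that the merged vector solves the new system.
-/
theorem nodeRedirectOn_solutionOf {C : Multigraph α → Prop}
    {Sol : Multigraph α → (α → ℝ≥0) → (α → ℝ) → Prop} (hwp : WellPosedOn C Sol)
    (h : ∀ (G : Multigraph α) (b : α → ℝ≥0) (u w : α) (h : G.OutTwins u w) (x : α → ℝ),
      C G → C (G.redirect u w h.2.1 h.2.2.1) → Sol G b x →
      Sol (G.redirect u w h.2.1 h.2.2.1) (redirectWeights b u w) (redirectValues x u w)) :
    NodeRedirectOn C (solutionOf Sol) := by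
  intro G b u w huw hG hG'
  have h1 := h G b u w huw _ hG hG' (solutionOf_spec hwp hG b)
  rw [(hwp _ (redirectWeights b u w) hG').1.unique (solutionOf_spec hwp hG' _) h1]
  exact ⟨fun v _ hvu hvw => (redirectValues_of_ne hvu hvw).symm,
    (redirectValues_right huw.2.2.1).symm⟩

theorem nodeRedirectOn_katzCentrality {a : ℝ} (ha : 0 ≤ a) :
    NodeRedirectOn (α := α) (fun G => G.KatzClass a) (katzCentrality a) := by
  refine nodeRedirectOn_solutionOf (wellPosedOn_isKatz ha) fun G b u w h x _ _ hx => ?_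
  have hf : ∀ t ∈ G.nodes, t ≠ u → t ≠ w → redirectValues x u w t = x t :=
    fun t _ => redirectValues_of_ne
  have hfw := redirectValues_right (x := x) h.2.2.1
  refine ⟨forall_mem_redirect h ?_ fun v hv hvu hvw => ?_, redirectValues_eq_zero h hx.2⟩
  · rw [hfw, sum_inEdges_redirect_self h hf hfw, redirectWeights_right, hx.1 u h.1, hx.1 w h.2.1]
    push_cast
    ring
  · rw [hf v hv hvu hvw, sum_inEdges_redirect_of_ne h hf hfw hvu hvw, redirectWeights_of_ne hvw,
      hx.1 v hv]

theorem nodeRedirectOn_bonacichCentrality {a : ℝ} (ha : 0 ≤ a) :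
    NodeRedirectOn (α := α) (fun G => G.KatzClass a) (bonacichCentrality a) := by
  refine nodeRedirectOn_solutionOf (wellPosedOn_isBonacich ha) fun G b u w h x _ _ hx => ?_
  have hf : ∀ t ∈ G.nodes, t ≠ u → t ≠ w →
      a * redirectValues x u w t + (redirectWeights b u w t : ℝ) = a * x t + (b t : ℝ) :=
    fun t _ htu htw => by rw [redirectValues_of_ne htu htw, redirectWeights_of_ne htw]
  have hfw : a * redirectValues x u w w + (redirectWeights b u w w : ℝ) =
      (a * x u + (b u : ℝ)) + (a * x w + (b w : ℝ)) := by
    rw [redirectValues_right h.2.2.1, redirectWeights_right]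
    push_cast
    ring
  refine ⟨forall_mem_redirect h ?_ fun v hv hvu hvw => ?_, redirectValues_eq_zero h hx.2⟩
  · exact (redirectValues_right h.2.2.1).trans <| by
      rw [hx.1 u h.1, hx.1 w h.2.1]
      exact (sum_inEdges_redirect_self h hf hfw).symm
  · exact (redirectValues_of_ne hvu hvw).trans <| (hx.1 v hv).trans
      (sum_inEdges_redirect_of_ne h hf hfw hvu hvw).symm

theorem nodeRedirectOn_katzPrestige :
    NodeRedirectOn (α := α) StronglyConnected katzPrestige := by
  refine nodeRedirectOn_solutionOf wellPosedOn_isKatzPrestige fun G b u w h x _ _ hx => ?_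
  have hf : ∀ t ∈ G.nodes, t ≠ u → t ≠ w →
      redirectValues x u w t / ((G.redirect u w h.2.1 h.2.2.1).outDegree t : ℝ) =
        x t / (G.outDegree t : ℝ) :=
    fun t _ htu htw => by rw [redirectValues_of_ne htu htw, outDegree_redirect h htu]
  -- Twins have a common out-degree, which redirecting preserves, so the shares sent along an edge
  -- simply add.
  have hfw : redirectValues x u w w / ((G.redirect u w h.2.1 h.2.2.1).outDegree w : ℝ) =
      x u / (G.outDegree u : ℝ) + x w / (G.outDegree w : ℝ) := by
    rw [redirectValues_right h.2.2.1, outDegree_redirect h h.2.2.1.symm, h.outDegree_eq, add_div]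
  refine ⟨forall_mem_redirect h ?_ fun v hv hvu hvw => ?_, (sum_redirectValues h).trans hx.2.1,
    redirectValues_eq_zero h hx.2.2⟩
  · exact (redirectValues_right h.2.2.1).trans <| by
      rw [hx.1 u h.1, hx.1 w h.2.1]
      exact (sum_inEdges_redirect_self h hf hfw).symm
  · exact (redirectValues_of_ne hvu hvw).trans <| (hx.1 v hv).trans
      (sum_inEdges_redirect_of_ne h hf hfw hvu hvw).symm

theorem nodeRedirectOn_eigenvectorCentrality :
    NodeRedirectOn (α := α) StronglyConnected eigenvectorCentrality := by
  refine nodeRedirectOn_solutionOf wellPosedOn_isEigenvector fun G b u w h x hG hG' hx => ?_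
  have hf : ∀ t ∈ G.nodes, t ≠ u → t ≠ w → redirectValues x u w t = x t :=
    fun t _ => redirectValues_of_ne
  have hfw := redirectValues_right (x := x) h.2.2.1
  have hsum := (sum_redirectValues h).trans hx.2.1
  have heq : ∀ v ∈ (G.redirect u w h.2.1 h.2.2.1).nodes, redirectValues x u w v =
      1 / G.eigenMax * (((G.redirect u w h.2.1 h.2.2.1).inEdges v).map
        fun e => redirectValues x u w e.1).sum := by
    refine forall_mem_redirect h ?_ fun v hv hvu hvw => ?_
    · rw [hfw, sum_inEdges_redirect_self h hf hfw, mul_add, ← hx.1 u h.1, ← hx.1 w h.2.1]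
    · rw [hf v hv hvu hvw, sum_inEdges_redirect_of_ne h hf hfw hvu hvw, ← hx.1 v hv]
  have hnn := redirectValues_nonneg h ((wellPosedOn_isEigenvector G b hG).2 x hx)
  -- The merged vector is a nonzero non-negative eigenvector of the new graph for the old
  -- eigenvalue, which is therefore the new maximum.
  have hmax : G.eigenMax = (G.redirect u w h.2.1 h.2.2.1).eigenMax := by
    have := hG'.1.to_subtype
    refine eq_sSup_realEigenvalues_of_nonneg adjMatrix_nonneg hG'.adjMatrix hG'.adjMatrix_ne_zero
      (x := fun i => redirectValues x u w i) (fun i => hnn i i.2) (fun h0 => ?_) ?_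
    · rw [← sum_nodes_eq] at hsum
      simp [funext_iff] at h0
      simp [h0] at hsum
    · ext v
      rw [adjMatrix_mulVec, Pi.smul_apply, smul_eq_mul, heq v v.2, ← mul_assoc,
        mul_one_div_cancel hG.eigenMax_pos.ne', one_mul]
  exact ⟨by rwa [← hmax], hsum, redirectValues_eq_zero h hx.2.2⟩

end CentralityAxioms

/-! ### The three-node counterexample -/

namespace CentralityAxioms

variable {α : Type*}

namespace Multigraph

variable {G : Multigraph α} {s t v : α}

theorem hasPath_one (h : (s, t) ∈ G.edges) : G.HasPath 1 s t :=
  ⟨![s, t], ⟨le_rfl, fun i => by fin_cases i; exact h⟩, rfl, rfl⟩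

theorem hasPath_two (h : (s, v) ∈ G.edges) (h' : (v, t) ∈ G.edges) : G.HasPath 2 s t :=
  ⟨![s, v, t], ⟨one_le_two, fun i => by fin_cases i; exacts [h, h']⟩, rfl, rfl⟩

theorem HasPath.one_le {k : ℕ} (h : G.HasPath k s t) : 1 ≤ k := by
  obtain ⟨p, ⟨hk, -⟩, -⟩ := h
  exact hk

theorem mem_edges_of_hasPath_one (h : G.HasPath 1 s t) : (s, t) ∈ G.edges := by
  obtain ⟨p, ⟨-, hp⟩, rfl, rfl⟩ := h
  exact hp 0

theorem dist_eq_one (h : (s, t) ∈ G.edges) : G.dist s t = 1 :=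
  le_antisymm (Nat.sInf_le (hasPath_one h)) (le_csInf ⟨1, hasPath_one h⟩ fun _ => HasPath.one_le)

theorem dist_eq_two (h : (s, v) ∈ G.edges) (h' : (v, t) ∈ G.edges) (hst : (s, t) ∉ G.edges) :
    G.dist s t = 2 := by
  refine le_antisymm (Nat.sInf_le (hasPath_two h h')) (le_csInf ⟨2, hasPath_two h h'⟩ fun k hk => ?_)
  refine lt_of_le_of_ne (HasPath.one_le hk) ?_
  rintro rfl
  exact hst (mem_edges_of_hasPath_one hk)

theorem stronglyConnected_of_hub (hv : v ∈ G.nodes) (hne : ∃ x ∈ G.nodes, x ≠ v)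
    (h : ∀ x ∈ G.nodes, x ≠ v → (x, v) ∈ G.edges ∧ (v, x) ∈ G.edges) : G.StronglyConnected := by
  refine ⟨⟨v, hv⟩, fun x hx y hy => ?_⟩
  by_cases hxv : x = v <;> by_cases hyv : y = v
  -- The hub reaches itself by a detour through another node, as the empty path is not allowed.
  · obtain ⟨z, hz, hzv⟩ := hne
    rw [hxv, hyv]
    exact ⟨2, hasPath_two (h z hz hzv).2 (h z hz hzv).1⟩
  · rw [hxv]
    exact ⟨1, hasPath_one (h y hy hyv).2⟩
  · rw [hyv]
    exact ⟨1, hasPath_one (h x hx hxv).1⟩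
  · exact ⟨2, hasPath_two (h x hx hxv).1 (h y hy hyv).2⟩

variable [DecidableEq α]

theorem numShortest_ne_zero (h : (s, v) ∈ G.edges) (h' : (v, t) ∈ G.edges)
    (hst : (s, t) ∉ G.edges) : G.numShortest s t ≠ 0 := by
  rw [numShortest, dist_eq_two h h' hst, numPaths]
  refine (Finset.sum_pos' (fun _ _ => Nat.zero_le _) ⟨![s, v, t], ?_, ?_⟩).ne'
  · refine Finset.mem_filter.2 ⟨Fintype.mem_piFinset.2 fun i => ?_, rfl, rfl⟩
    fin_cases i
    exacts [G.fst_mem _ h, G.snd_mem _ h, G.snd_mem _ h']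
  · refine Finset.prod_pos fun i _ => Multiset.count_pos.2 ?_
    fin_cases i
    exacts [h, h']

/-- As `v` is the only out-neighbour of `s`, any node sequence with nonzero edge product has `v` at
position `1`, so the restriction discards only zero terms. -/
theorem numShortestThrough_eq (h : (s, v) ∈ G.edges) (h' : (v, t) ∈ G.edges)
    (hst : (s, t) ∉ G.edges) (hs : ∀ x, (s, x) ∈ G.edges → x = v) :
    G.numShortestThrough s t v = G.numShortest s t := by
  rw [numShortest, numShortestThrough, dist_eq_two h h' hst, numPaths, numPathsThrough]
  refine Finset.sum_filter_of_ne fun p hp hne => ⟨1, hs _ ?_⟩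
  rw [← (Finset.mem_filter.1 hp).2.1]
  exact Multiset.count_ne_zero.1 (Finset.prod_ne_zero_iff.1 hne 0 (Finset.mem_univ _))

end Multigraph

open Multigraph

variable [DecidableEq α] {u v w : α}

theorem exampleGraph_inEdges (huv : u ≠ v) (hvw : v ≠ w) : (exampleGraph u v w).inEdges v = {(u, v), (w, v)} := by
  simp [inEdges, exampleGraph, Multiset.filter_singleton, huv, hvw.symm]

theorem exampleGraph_outTwins (huw : u ≠ w) (huv : u ≠ v) (hvw : v ≠ w) :
    (exampleGraph u v w).OutTwins u w := by
  refine ⟨by simp [exampleGraph], by simp [exampleGraph], huw, fun t => ?_⟩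
  simp [mult, exampleGraph, Multiset.count_cons, huw, huw.symm, huv,
    hvw.symm]

theorem exampleGraph_nodes_erase (huw : u ≠ w) (huv : u ≠ v) (hvw : v ≠ w) :
    (exampleGraph u v w).nodes.erase v = {u, w} := by
  ext x
  simp only [exampleGraph, Finset.mem_erase, Finset.mem_insert, Finset.mem_singleton]
  constructor
  · rintro ⟨h1, h2 | h2 | h2⟩ <;> simp_all
  · rintro (rfl | rfl)
    exacts [⟨huv, Or.inl rfl⟩, ⟨hvw.symm, Or.inr (Or.inr rfl)⟩]

theorem exampleGraph_outDegree (huw : u ≠ w) (huv : u ≠ v) (hvw : v ≠ w) :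
    (exampleGraph u v w).outDegree u = 1 ∧ (exampleGraph u v w).outDegree w = 1 := by
  simp [outDegree, outEdges, exampleGraph, Multiset.filter_singleton,
    huv.symm, hvw, huw, huw.symm]

theorem exampleGraph_stronglyConnected (huw : u ≠ w) (huv : u ≠ v) (hvw : v ≠ w) :
    (exampleGraph u v w).StronglyConnected := by
  refine stronglyConnected_of_hub (v := v) (by simp [exampleGraph])
    ⟨u, by simp [exampleGraph], huv⟩ fun x hx hxv => ?_
  have hx' := Finset.mem_erase.2 ⟨hxv, hx⟩
  rw [exampleGraph_nodes_erase huw huv hvw, Finset.mem_insert, Finset.mem_singleton] at hx'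
  rcases hx' with rfl | rfl <;> simp [exampleGraph]

theorem exampleGraph_redirect_nodes (huw : u ≠ w) (huv : u ≠ v) (hvw : v ≠ w) :
    ((exampleGraph u v w).redirect u w (mem_exampleGraph u v w) huw).nodes = {v, w} := by
  ext x
  simp only [redirect, exampleGraph, Finset.mem_erase, Finset.mem_insert, Finset.mem_singleton]
  constructor
  · rintro ⟨h1, h2 | h2 | h2⟩ <;> simp_all
  · rintro (rfl | rfl)
    exacts [⟨huv.symm, Or.inr (Or.inl rfl)⟩, ⟨huw.symm, Or.inr (Or.inr rfl)⟩]

/-- The edge `(v, u)` turns into a second copy of `(v, w)`, whereas `(u, v)` disappears; `v` keeps a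
single incoming edge. -/
theorem exampleGraph_redirect_edges (huw : u ≠ w) (huv : u ≠ v) (hvw : v ≠ w) :
    ((exampleGraph u v w).redirect u w (mem_exampleGraph u v w) huw).edges =
      {(w, v), (v, w), (v, w)} := by
  have h1 : (exampleGraph u v w).inEdges u = {(v, u)} := by
    simp [inEdges, exampleGraph, Multiset.filter_singleton, huv.symm,
      huw.symm]
  have h2 : (exampleGraph u v w).edges - (exampleGraph u v w).outEdges u =
      {(w, v), (v, u), (v, w)} := by
    rw [outEdges, Multiset.sub_filter_eq_filter_not]
    simp [exampleGraph, Multiset.filter_singleton, huv.symm, huw.symm]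
  have h3 : ({(w, v), (v, u), (v, w)} : Multiset (α × α)) - {(v, u)} = {(w, v), (v, w)} := by
    rw [Multiset.sub_singleton, Multiset.insert_eq_cons, Multiset.insert_eq_cons,
      Multiset.erase_cons_tail _ (by simp [hvw.symm]), Multiset.erase_cons_head]
    rfl
  change (exampleGraph u v w).edges - (exampleGraph u v w).outEdges u -
    (exampleGraph u v w).inEdges u + Multiset.map _ (Multiset.filter _
      ((exampleGraph u v w).inEdges u)) = _
  rw [h2, h1, h3]
  simp [Multiset.filter_singleton, huv.symm]

theorem closenessCentrality_of_nodes_erase {G : Multigraph α} {b : α → ℝ≥0} (N : Finset α)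
    (hN : G.nodes.erase v = N) (h : ∀ x ∈ N, (x, v) ∈ G.edges) :
    closenessCentrality G b v = 1 / (N.card : ℝ) := by
  rw [closenessCentrality, hN, Finset.sum_congr rfl fun x hx => by rw [dist_eq_one (h x hx)]]
  simp

theorem decayCentrality_of_nodes_erase {G : Multigraph α} {b : α → ℝ≥0} (a : ℝ) (N : Finset α)
    (hN : G.nodes.erase v = N) (h : ∀ x ∈ N, (x, v) ∈ G.edges) :
    decayCentrality a G b v = N.card * a := by
  rw [decayCentrality, hN, Finset.sum_congr rfl fun x hx => by
    rw [dist_eq_one (h x hx), if_pos ⟨1, hasPath_one (h x hx)⟩, pow_one]]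
  simp

theorem betweennessCentrality_exampleGraph (huw : u ≠ w) (huv : u ≠ v) (hvw : v ≠ w)
    (b : α → ℝ≥0) : betweennessCentrality (exampleGraph u v w) b v = 2 := by
  -- Stated for an arbitrary ordering of the pair, so that it applies to both `(u, w)` and `(w, u)`;
  -- each contributes `1`.
  have key : ∀ s t, ({u, w} : Finset α) = {s, t} → s ≠ t → s ≠ v → (s, v) ∈ (exampleGraph u v w).edges →
      (v, t) ∈ (exampleGraph u v w).edges →
      ∑ t ∈ ({u, w} : Finset α).filter fun t => s ≠ t ∧ (exampleGraph u v w).numShortest s t ≠ 0,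
        ((exampleGraph u v w).numShortestThrough s t v : ℝ) /
          ((exampleGraph u v w).numShortest s t : ℝ) = 1 := by
    intro s t hst hne hsv hs ht
    have hsx : ∀ x, (s, x) ∈ (exampleGraph u v w).edges → x = v := by
      intro x hx
      simp only [exampleGraph, Multiset.insert_eq_cons, Multiset.mem_cons, Multiset.mem_singleton,
        Prod.mk.injEq] at hx
      rcases hx with hx | hx | hx | hx
      exacts [hx.2, hx.2, absurd hx.1 hsv, absurd hx.1 hsv]
    have htv : t ≠ v := by
      have : t ∈ ({u, w} : Finset α) := by simp [hst]
      rcases Finset.mem_insert.1 this with rfl | h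
      · exact huv
      · rw [Finset.mem_singleton.1 h]
        exact hvw.symm
    have hnst : (s, t) ∉ (exampleGraph u v w).edges := fun h => htv (hsx t h)
    have h0 := numShortest_ne_zero hs ht hnst
    have hfilter : (({u, w} : Finset α).filter fun t =>
        s ≠ t ∧ (exampleGraph u v w).numShortest s t ≠ 0) = {t} := by
      rw [hst, Finset.filter_insert, if_neg (by simp), Finset.filter_singleton, if_pos ⟨hne, h0⟩]
    rw [hfilter, Finset.sum_singleton, numShortestThrough_eq hs ht hnst hsx,
      div_self (Nat.cast_ne_zero.2 h0)]
  rw [betweennessCentrality, exampleGraph_nodes_erase huw huv hvw, Finset.sum_pair huw,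
    key u w rfl huw huv (by simp [exampleGraph]) (by simp [exampleGraph]),
    key w u (Finset.pair_comm u w) huw.symm hvw.symm (by simp [exampleGraph])
      (by simp [exampleGraph])]
  norm_num

theorem not_nodeRedirectOn_of_ne {C : Multigraph α → Prop} {F : Centrality α} (huw : u ≠ w)
    (huv : u ≠ v) (hvw : v ≠ w) (hC : C (exampleGraph u v w))
    (hC' : C ((exampleGraph u v w).redirect u w (mem_exampleGraph u v w) huw))
    (h : F (exampleGraph u v w) (fun _ => 1) v ≠
      F ((exampleGraph u v w).redirect u w (mem_exampleGraph u v w) huw)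
        (redirectWeights (fun _ => 1) u w) v) : ¬ NodeRedirectOn C F := fun hF =>
  h ((hF _ (fun _ => 1) u w (exampleGraph_outTwins huw huv hvw) hC hC').1 v
    (by simp [exampleGraph]) huv.symm hvw)

end CentralityAxioms

theorem CentralityAxioms.exampleGraph_values {α : Type*} [DecidableEq α] (u v w : α) (huw : u ≠ w) (huv : u ≠ v)
    (hvw : v ≠ w) :
    let G := CentralityAxioms.exampleGraph u v w
    let G' := G.redirect u w (CentralityAxioms.mem_exampleGraph u v w) huw
    let b : α → NNReal := fun _ => 1
    let b' : α → NNReal := CentralityAxioms.redirectWeights b u w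
    G.OutTwins u w ∧ G.StronglyConnected ∧ G'.StronglyConnected ∧
      CentralityAxioms.degreeCentrality G b v = 2 ∧
      CentralityAxioms.degreeCentrality G' b' v = 1 ∧
      CentralityAxioms.betaMeasure G b v = 2 ∧
      CentralityAxioms.betaMeasure G' b' v = 1 ∧
      CentralityAxioms.closenessCentrality G b v = 1 / 2 ∧
      CentralityAxioms.closenessCentrality G' b' v = 1 ∧
      (∀ a : ℝ, 0 < a → a < 1 →
        CentralityAxioms.decayCentrality a G b v = 2 * a ∧
        CentralityAxioms.decayCentrality a G' b' v = a) ∧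
      CentralityAxioms.betweennessCentrality G b v = 2 ∧
      CentralityAxioms.betweennessCentrality G' b' v = 0 := by
  intro G G' b b'
  have hN : G.nodes.erase v = {u, w} := exampleGraph_nodes_erase huw huv hvw
  have hG : ∀ x ∈ ({u, w} : Finset α), (x, v) ∈ G.edges := by simp [G, exampleGraph]
  have hnodes : G'.nodes = {v, w} := exampleGraph_redirect_nodes huw huv hvw
  have hedges : G'.edges = {(w, v), (v, w), (v, w)} := exampleGraph_redirect_edges huw huv hvw
  have hN' : G'.nodes.erase v = {w} := by
    rw [hnodes, Finset.erase_insert (by simpa using hvw)]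
  have hG' : ∀ x ∈ ({w} : Finset α), (x, v) ∈ G'.edges := by simp [hedges]
  have hin : G.inEdges v = {(u, v), (w, v)} := exampleGraph_inEdges huv hvw
  have hin' : G'.inEdges v = {(w, v)} := by
    simp [Multigraph.inEdges, hedges, Multiset.filter_singleton, hvw.symm]
  have hout' : G'.outDegree w = 1 := by
    simp [Multigraph.outDegree, Multigraph.outEdges, hedges, 
      Multiset.filter_singleton, hvw]
  obtain ⟨hout₁, hout₂⟩ : G.outDegree u = 1 ∧ G.outDegree w = 1 :=
    exampleGraph_outDegree huw huv hvw
  refine ⟨exampleGraph_outTwins huw huv hvw, exampleGraph_stronglyConnected huw huv hvw,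
    Multigraph.stronglyConnected_of_hub (v := v) (by simp [hnodes]) ⟨w, by simp [hnodes], hvw.symm⟩
      fun x hx hxv => ?_, ?_, ?_, ?_, ?_, ?_, ?_, fun a _ _ => ⟨?_, ?_⟩,
    betweennessCentrality_exampleGraph huw huv hvw b, ?_⟩
  · have hx' := Finset.mem_erase.2 ⟨hxv, hx⟩
    rw [hN', Finset.mem_singleton] at hx'
    subst hx'
    simp [hedges]
  · simp [degreeCentrality, hin]
  · simp [degreeCentrality, hin']
  · simp [betaMeasure, hin, hout₁, hout₂]
    norm_num
  · simp [betaMeasure, hin', hout']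
  · rw [closenessCentrality_of_nodes_erase _ hN hG, Finset.card_pair huw]
    norm_num
  · rw [closenessCentrality_of_nodes_erase _ hN' hG']
    simp
  · rw [decayCentrality_of_nodes_erase a _ hN hG, Finset.card_pair huw]
    norm_num
  · rw [decayCentrality_of_nodes_erase a _ hN' hG']
    simp
  -- Only `w` remains besides `v`, so there is no pair of distinct endpoints.
  · rw [betweennessCentrality, hN', Finset.sum_singleton, Finset.filter_singleton]
    simp

theorem mainTheorem9 {α : Type*} [DecidableEq α] [Infinite α] :
    -- the four recursively defined centralities are well defined on their classes of graphs
    (CentralityAxioms.WellPosedOn (α := α) CentralityAxioms.Multigraph.StronglyConnected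
        CentralityAxioms.IsEigenvector ∧
      CentralityAxioms.WellPosedOn (α := α) CentralityAxioms.Multigraph.StronglyConnected
        CentralityAxioms.IsKatzPrestige ∧
      (∀ a : ℝ, 0 < a → a < 1 →
        CentralityAxioms.WellPosedOn (α := α) (fun G => G.KatzClass a)
          (CentralityAxioms.IsKatz a)) ∧
      (∀ a : ℝ, 0 < a → a < 1 →
        CentralityAxioms.WellPosedOn (α := α) (fun G => G.KatzClass a)
          (CentralityAxioms.IsBonacich a))) ∧
    -- and satisfy Node Redirect there
    (CentralityAxioms.NodeRedirectOn (α := α) CentralityAxioms.Multigraph.StronglyConnected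
        CentralityAxioms.eigenvectorCentrality ∧
      CentralityAxioms.NodeRedirectOn (α := α) CentralityAxioms.Multigraph.StronglyConnected
        CentralityAxioms.katzPrestige ∧
      (∀ a : ℝ, 0 < a → a < 1 →
        CentralityAxioms.NodeRedirectOn (α := α) (fun G => G.KatzClass a)
          (CentralityAxioms.katzCentrality a)) ∧
      (∀ a : ℝ, 0 < a → a < 1 →
        CentralityAxioms.NodeRedirectOn (α := α) (fun G => G.KatzClass a)
          (CentralityAxioms.bonacichCentrality a))) ∧
    -- the five other measures do not satisfy Node Redirect
    (¬ CentralityAxioms.NodeRedirectOn (α := α) (fun _ => True)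
        CentralityAxioms.degreeCentrality ∧
      ¬ CentralityAxioms.NodeRedirectOn (α := α) (fun _ => True)
        CentralityAxioms.betaMeasure ∧
      ¬ CentralityAxioms.NodeRedirectOn (α := α) CentralityAxioms.Multigraph.StronglyConnected
        CentralityAxioms.closenessCentrality ∧
      (∀ a : ℝ, 0 < a → a < 1 →
        ¬ CentralityAxioms.NodeRedirectOn (α := α) (fun _ => True)
          (CentralityAxioms.decayCentrality a)) ∧
      ¬ CentralityAxioms.NodeRedirectOn (α := α) (fun _ => True)
        CentralityAxioms.betweennessCentrality) ∧
    -- as one strongly connected example shows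
    (∀ (u v w : α) (huw : u ≠ w), u ≠ v → v ≠ w →
      let G := CentralityAxioms.exampleGraph u v w
      let G' := G.redirect u w (CentralityAxioms.mem_exampleGraph u v w) huw
      let b : α → NNReal := fun _ => 1
      let b' : α → NNReal := CentralityAxioms.redirectWeights b u w
      G.OutTwins u w ∧ G.StronglyConnected ∧ G'.StronglyConnected ∧
      CentralityAxioms.degreeCentrality G b v = 2 ∧
      CentralityAxioms.degreeCentrality G' b' v = 1 ∧
      CentralityAxioms.betaMeasure G b v = 2 ∧
      CentralityAxioms.betaMeasure G' b' v = 1 ∧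
      CentralityAxioms.closenessCentrality G b v = 1 / 2 ∧
      CentralityAxioms.closenessCentrality G' b' v = 1 ∧
      (∀ a : ℝ, 0 < a → a < 1 →
        CentralityAxioms.decayCentrality a G b v = 2 * a ∧
        CentralityAxioms.decayCentrality a G' b' v = a) ∧
      CentralityAxioms.betweennessCentrality G b v = 2 ∧
      CentralityAxioms.betweennessCentrality G' b' v = 0) := by
  have values := fun u v w : α => CentralityAxioms.exampleGraph_values u v w
  refine ⟨⟨CentralityAxioms.wellPosedOn_isEigenvector, CentralityAxioms.wellPosedOn_isKatzPrestige,
    fun a ha _ => CentralityAxioms.wellPosedOn_isKatz ha.le,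
    fun a ha _ => CentralityAxioms.wellPosedOn_isBonacich ha.le⟩,
    ⟨CentralityAxioms.nodeRedirectOn_eigenvectorCentrality,
    CentralityAxioms.nodeRedirectOn_katzPrestige,
    fun a ha _ => CentralityAxioms.nodeRedirectOn_katzCentrality ha.le,
    fun a ha _ => CentralityAxioms.nodeRedirectOn_bonacichCentrality ha.le⟩, ?_, values⟩
  -- Infinitude of `α` supplies the three distinct nodes of the counterexample.
  obtain ⟨u, v, w, huv, huw, hvw⟩ : ∃ u v w : α, u ≠ v ∧ u ≠ w ∧ v ≠ w := by
    obtain ⟨s, hs⟩ := Infinite.exists_subset_card_eq α 3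
    obtain ⟨u, v, w, huv, huw, hvw, -⟩ := Finset.card_eq_three.1 hs
    exact ⟨u, v, w, huv, huw, hvw⟩
  obtain ⟨-, hG, hG', hD, hD', hB, hB', hC, hC', hY, hW, hW'⟩ := values u v w huw huv hvw
  refine ⟨CentralityAxioms.not_nodeRedirectOn_of_ne huw huv hvw trivial trivial ?_,
    CentralityAxioms.not_nodeRedirectOn_of_ne huw huv hvw trivial trivial ?_,
    CentralityAxioms.not_nodeRedirectOn_of_ne huw huv hvw hG hG' ?_, fun a ha ha' =>
    CentralityAxioms.not_nodeRedirectOn_of_ne huw huv hvw trivial trivial ?_,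
    CentralityAxioms.not_nodeRedirectOn_of_ne huw huv hvw trivial trivial ?_⟩
  · rw [hD, hD']
    norm_num
  · rw [hB, hB']
    norm_num
  · rw [hC, hC']
    norm_num
  · rw [(hY a ha ha').1, (hY a ha ha').2]
    linarith
  · rw [hW, hW']
    norm_num
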